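/- Let $\Gamma$ be a group with a finite generating set $S$, and let $d_S$ be the left-invariant word metric. Let $\beta_\Gamma=\delta(1)\in H^1(\Gamma,I(\Gamma))$ be the Berstein–Schwarz class, where $\delta:H^0(\Gamma,\mathbb Z)\to H^1(\Gamma,I(\Gamma))$ is the connecting homomorphism of the augmentation sequence $0\to I(\Gamma)\to\mathbb Z\Gamma\xrightarrow{\ \varepsilon\ }\mathbb Z\to 0$. If the class $1\in H^0(\Gamma,\mathbb Z)$ is proper Lipschitz, then $\beta_\Gamma$ is proper Lipschitz. Here proper Lipschitz classes are defined as follows. Consider a connected, locally finite, finite-dimensional simplicial complex $P$ with a simplicial action of $\Gamma$ that is free on $|P|$, and a map $\alpha:\Gamma\times |P|\to\mathbb R^n$ such that (1) $\alpha(g\gamma,gx)=\alpha(\gamma,x)$ for all $g,\gamma\in\Gamma$, $x\in |P|$; (2) $\alpha(\gamma,\cdot):|P|\to\mathbb R^n$ is continuous and proper for every $\gamma\in\Gamma$; (3) $|\alpha(\gamma,x)-\alpha(\gamma',x)|\le d_S(\gamma,\gamma')$ for all $\gamma,\gamma'\in\Gamma$, $x\in |P|$. Extend $\alpha$ to simplices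 $[\gamma_0,\dots,\gamma_k]$ spanned by elements of $\Gamma$ by $\bar\alpha(\sum t_i\gamma_i,x)=\sum t_i\,\alpha(\gamma_i,x)$, and let $\omega$ be a compactly supported integral singular cocycle on $\mathbb R^n$ whose class generates $H^n_c(\mathbb R^n;\mathbb Z)$. For a $\mathbb Z\Gamma$-module $L$ let $H_*(P:\Gamma;L)$ be the homology of the complex of (possibly infinite) ordered simplicial chains $z=\sum_\sigma\lambda_\sigma\sigma$ of $P$ with $\lambda_\sigma\in L$ and $\lambda_{\gamma\sigma}=\gamma\lambda_\sigma$. The homomorphism $\alpha_\cap:H_{n-k}(P:\Gamma;L)\to H^k(\Gamma,L)$ sends the class of an invariant cycle $z=\sum_\sigma\lambda_\sigma\sigma$ to the class of the cocycle $$[\gamma_0,\dots,\gamma_k]\longmapsto\sum_\sigma\omega\big(\bar\alpha|_{[\gamma_0,\dots,\gamma_k]\times\sigma}\big)\,\lambda_\sigma ,$$ where $[\gamma_0,\dots,\gamma_k]\times\sigma$ is regarded as a singular $n$-chain by means of the staircase triangulation. A class in $H^k(\Gamma,L)$ is called proper Lipschitz if it lies in the image of $\alpha_\cap$ for some such $P$,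 $n$, $\alpha$, $\omega$. -/

import Mathlib

open CategoryTheory

noncomputable section

/-! ### Compactly supported integral singular cohomology -/

namespace CompactCohomology

/-- The `i`-th face inclusion of standard simplices. -/
def faceMap {m : ℕ} (i : Fin (m + 2)) :
    C(stdSimplex ℝ (Fin (m + 1)), stdSimplex ℝ (Fin (m + 2))) :=
  ⟨stdSimplex.map i.succAbove, stdSimplex.continuous_map _⟩

/-- Integral singular `m`-cochains of `X`: integer functions on singular `m`-simplices. -/
abbrev Cochain (X : Type*) [TopologicalSpace X] (m : ℕ) : Type _ :=
  C(stdSimplex ℝ (Fin (m + 1)), X) → ℤ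

/-- The singular coboundary. -/
def coboundary (X : Type*) [TopologicalSpace X] (m : ℕ) : Cochain X m →+ Cochain X (m + 1) where
  toFun ω τ := ∑ i : Fin (m + 2), (-1 : ℤ) ^ (i : ℕ) * ω (τ.comp (faceMap i))
  map_zero' := by
    funext τ
    simp
  map_add' ω η := by
    funext τ
    simp [mul_add, Finset.sum_add_distrib]

/-- Compactly supported cochains: those that vanish on all singular simplices whose image
misses some compact set. -/
def compactCochains (X : Type*) [TopologicalSpace X] (m : ℕ) : AddSubgroup (Cochain X m) where
  carrier := {ω | ∃ K : Set X, IsCompact K ∧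
    ∀ τ : C(stdSimplex ℝ (Fin (m + 1)), X), Disjoint (Set.range τ) K → ω τ = 0}
  zero_mem' := ⟨∅, isCompact_empty, fun _ _ => rfl⟩
  add_mem' := by
    rintro ω η ⟨K, hK, hω⟩ ⟨L, hL, hη⟩
    refine ⟨K ∪ L, hK.union hL, fun τ hτ => ?_⟩
    rw [Set.disjoint_union_right] at hτ
    simp [hω τ hτ.1, hη τ hτ.2]
  neg_mem' := by
    rintro ω ⟨K, hK, hω⟩
    exact ⟨K, hK, fun τ hτ => by simp [hω τ hτ]⟩

/-- Compactly supported `m`-cocycles. -/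
def cocycles (X : Type*) [TopologicalSpace X] (m : ℕ) : AddSubgroup (Cochain X m) :=
  compactCochains X m ⊓ (coboundary X m).ker

/-- Coboundaries of compactly supported cochains. -/
def coboundaries (X : Type*) [TopologicalSpace X] : (m : ℕ) → AddSubgroup (Cochain X m)
  | 0 => ⊥
  | m + 1 => (compactCochains X m).map (coboundary X m)

/-- `H^m_c(X; ℤ)`. -/
abbrev H (X : Type*) [TopologicalSpace X] (m : ℕ) : Type _ :=
  cocycles X m ⧸ (coboundaries X m).addSubgroupOf (cocycles X m)

/-- The class of the compactly supported cocycle `ω` generates `H^m_c(X; ℤ)`. -/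
def IsGenerator {X : Type*} [TopologicalSpace X] {m : ℕ} (ω : cocycles X m) : Prop :=
  AddSubgroup.zmultiples (QuotientAddGroup.mk ω : H X m) = ⊤

end CompactCohomology

/-! ### Simplicial complexes with a free simplicial action -/

/-- The geometric realization of `K` in barycentric coordinates, with the topology of pointwise
convergence of the coordinates. When `K` is locally finite this agrees with the weak topology. -/
def realization {V : Type*} (K : AbstractSimplicialComplex V) : Set (V → ℝ) :=
  {x | (∀ v, 0 ≤ x v) ∧ ∃ s ∈ K, (∀ v, v ∉ s → x v = 0) ∧ ∑ v ∈ s, x v = 1}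

/-- A simplicial complex with an action of `Γ` by simplicial automorphisms. (Connected locally
finite complexes are countable, so it is no restriction that the vertices form a `Type`.) -/
structure SimplicialGComplex (Γ : Type*) [Group Γ] where
  V : Type
  K : AbstractSimplicialComplex V
  [action : MulAction Γ V]
  smul_mem : ∀ (g : Γ), ∀ s ∈ K, s.map (MulAction.toPerm g).toEmbedding ∈ K

namespace SimplicialGComplex

variable {Γ : Type*} [Group Γ] (P : SimplicialGComplex Γ)

instance : MulAction Γ P.V := P.action

/-- The points of the realization `|P|`. -/
abbrev Point : Type := realization P.K

/-- The induced action of `Γ` on `|P|`. -/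
def smulPoint (g : Γ) (x : P.Point) : P.Point :=
  ⟨fun v => x.1 (g⁻¹ • v), fun v => x.2.1 _, by
    obtain ⟨s, hs, h0, h1⟩ := x.2.2
    refine ⟨_, P.smul_mem g s hs, fun v hv => h0 _ fun h => hv ?_, ?_⟩
    · exact Finset.mem_map.2 ⟨_, h, by simp⟩
    · simpa [Finset.sum_map] using h1⟩

/-- `P` is finite dimensional, locally finite and connected (in particular nonempty), and `Γ` acts
freely on `|P|`. -/
structure IsParameterSpace : Prop where
  finiteDimensional : ∃ d : ℕ, ∀ s ∈ P.K, s.card ≤ d + 1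
  locallyFinite : ∀ v : P.V, {s : Finset P.V | s ∈ P.K ∧ v ∈ s}.Finite
  connected : ConnectedSpace P.Point
  free : ∀ (g : Γ) (x : P.Point), P.smulPoint g x = x → g = 1

/-- Ordered `l`-simplices of `P`: sequences of `l + 1` vertices lying in a common simplex. -/
def Simplex (l : ℕ) : Type :=
  {σ : Fin (l + 1) → P.V // ∃ s ∈ P.K, ∀ i, σ i ∈ s}

variable {P}

namespace Simplex

/-- The `i`-th face. -/
def face {l : ℕ} (i : Fin (l + 2)) (σ : P.Simplex (l + 1)) : P.Simplex l :=
  ⟨fun j => σ.1 (i.succAbove j), by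
    obtain ⟨s, hs, h⟩ := σ.2
    exact ⟨s, hs, fun j => h _⟩⟩

/-- The translate of a simplex by a group element. -/
def translate {l : ℕ} (g : Γ) (σ : P.Simplex l) : P.Simplex l :=
  ⟨fun j => g • σ.1 j, by
    obtain ⟨s, hs, h⟩ := σ.2
    exact ⟨_, P.smul_mem g s hs, fun j => Finset.mem_map.2 ⟨_, h j, rfl⟩⟩⟩

open Classical in
/-- The affine map of the standard simplex onto an ordered simplex. -/
def toPoint {l : ℕ} (σ : P.Simplex l) : C(stdSimplex ℝ (Fin (l + 1)), P.Point) where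
  toFun t := ⟨fun v => ∑ i, if σ.1 i = v then t i else 0,
    fun v => Finset.sum_nonneg fun i _ => by
      split_ifs
      · exact t.2.1 i
      · exact le_rfl, by
    obtain ⟨s, hs, h⟩ := σ.2
    refine ⟨s, hs, fun v hv => Finset.sum_eq_zero fun i _ => if_neg ?_, ?_⟩
    · rintro rfl
      exact hv (h i)
    · rw [Finset.sum_comm, ← t.2.2]
      refine Finset.sum_congr rfl fun i _ => ?_
      rw [Finset.sum_ite_eq s (σ.1 i), if_pos (h i)]
      rfl⟩
  continuous_toFun := by
    refine Continuous.subtype_mk (continuous_pi fun v => continuous_finsetSum _ fun i _ => ?_) _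
    split_ifs
    · exact (continuous_apply i).comp continuous_subtype_val
    · exact continuous_const

end Simplex

/-- A possibly infinite simplicial chain `∑ λ_σ σ` with coefficients in `A` is invariant when
`λ_{gσ} = g λ_σ`. -/
def IsInvariant {A : Rep.{0} ℤ Γ} {l : ℕ} (z : P.Simplex l → A) : Prop :=
  ∀ (g : Γ) (σ : P.Simplex l), z (σ.translate g) = A.ρ g (z σ)

/-- The boundary of a possibly infinite chain: the coefficient at `τ` is the sum of
`(-1)^i λ_σ` over all `i` and `σ` such that `τ` is the `i`-th face of `σ`. -/
def boundary {A : Rep.{0} ℤ Γ} {l : ℕ} (z : P.Simplex (l + 1) → A) (τ : P.Simplex l) : A :=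
  ∑ i : Fin (l + 2), (-1 : ℤ) ^ (i : ℕ) • ∑ᶠ (σ : P.Simplex (l + 1)) (_ : σ.face i = τ), z σ

/-- Cycles. -/
def IsCycle {A : Rep.{0} ℤ Γ} : {l : ℕ} → (P.Simplex l → A) → Prop
  | 0, _ => True
  | _ + 1, z => ∀ τ, boundary z τ = 0

end SimplicialGComplex

/-! ### The slant product -/

/-- Word length with respect to `S`. -/
def wordLength {Γ : Type*} [Group Γ] (S : Set Γ) (g : Γ) : ℕ :=
  sInf {m | ∃ w : List Γ, w.length = m ∧ (∀ s ∈ w, s ∈ S ∨ s⁻¹ ∈ S) ∧ w.prod = g}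

/-- The (left invariant) word metric. -/
def wordDist {Γ : Type*} [Group Γ] (S : Set Γ) (g h : Γ) : ℕ := wordLength S (g⁻¹ * h)

/-- `ℝⁿ` with the Euclidean metric. -/
abbrev Euc (n : ℕ) : Type := EuclideanSpace ℝ (Fin n)

section Slant

variable {Γ : Type*} [Group Γ] {P : SimplicialGComplex Γ} {n : ℕ}

/-- The three conditions on `α : Γ × |P| → ℝⁿ`. -/
structure IsProperLipschitzMap (S : Set Γ) (α : Γ → P.Point → Euc n) : Prop where
  invariant : ∀ (g γ : Γ) (x : P.Point), α (g * γ) (P.smulPoint g x) = α γ x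
  proper : ∀ γ : Γ, IsProperMap (α γ)
  lipschitz : ∀ (x : P.Point) (γ γ' : Γ), dist (α γ x) (α γ' x) ≤ wordDist S γ γ'

/-- The extension `ᾱ(∑ tᵢ γᵢ, x) = ∑ tᵢ α(γᵢ, x)` on the simplex `[γ₀, …, γₖ]`. -/
def barExt (α : Γ → C(P.Point, Euc n)) {k : ℕ} (γ : Fin (k + 1) → Γ) :
    C(stdSimplex ℝ (Fin (k + 1)) × P.Point, Euc n) where
  toFun q := ∑ i, q.1 i • α (γ i) q.2
  continuous_toFun := by
    have h (i : Fin (k + 1)) : Continuous fun q : stdSimplex ℝ (Fin (k + 1)) × P.Point => q.1 i :=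
      (continuous_apply i).comp (continuous_subtype_val.comp continuous_fst)
    exact continuous_finsetSum _ fun i _ => (h i).smul ((α (γ i)).continuous.comp continuous_snd)

/-- The affine map of `Δⁿ` into `Δᵏ × Δˡ` sending the `j`-th vertex to the vertex `f j`. -/
def gridSimplex (n k l : ℕ) (f : Fin (n + 1) → Fin (k + 1) × Fin (l + 1)) :
    C(stdSimplex ℝ (Fin (n + 1)), stdSimplex ℝ (Fin (k + 1)) × stdSimplex ℝ (Fin (l + 1))) where
  toFun t := (stdSimplex.map (fun j => (f j).1) t, stdSimplex.map (fun j => (f j).2) t)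
  continuous_toFun := (stdSimplex.continuous_map _).prodMk (stdSimplex.continuous_map _)

/-- The sign of a lattice path: `(-1)` to the number of unit squares below it. -/
def gridSign (n k l : ℕ) (f : Fin (n + 1) → Fin (k + 1) × Fin (l + 1)) : ℤ :=
  (-1) ^ ∑ t : Fin n, (((f t.succ).1 : ℕ) - ((f t.castSucc).1 : ℕ)) * ((f t.castSucc).2 : ℕ)

open Classical in
/-- `ω(ᾱ|Δ × σ)` for `Δ = [γ₀, …, γₖ]` and an ordered `l`-simplex `σ`, where `k + l = n`:
the value of `ω` on the singular chain given by the staircase triangulation of `Δ × σ`, whose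
`n`-simplices are the strictly increasing sequences of `n + 1` vertices of the grid. -/
def crossValue (ω : CompactCohomology.Cochain (Euc n) n) (α : Γ → C(P.Point, Euc n)) {k l : ℕ}
    (γ : Fin (k + 1) → Γ) (σ : P.Simplex l) : ℤ :=
  ∑ f : Fin (n + 1) → Fin (k + 1) × Fin (l + 1), if StrictMono f then
    gridSign n k l f * ω ((barExt α γ).comp
      (((ContinuousMap.id _).prodMap σ.toPoint).comp (gridSimplex n k l f))) else 0

/-- The homogeneous cochain `[γ₀, …, γₖ] ↦ ∑_σ ω(ᾱ|[γ₀, …, γₖ] × σ) λ_σ`. -/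
def slant {A : Rep.{0} ℤ Γ} (ω : CompactCohomology.Cochain (Euc n) n)
    (α : Γ → C(P.Point, Euc n)) {k l : ℕ} (z : P.Simplex l → A) (γ : Fin (k + 1) → Γ) : A :=
  ∑ᶠ σ : P.Simplex l, crossValue ω α γ σ • z σ

end Slant

/-- A class `c ∈ Hᵏ(Γ; A)` is proper Lipschitz if it lies in the image of some graded homomorphism
`α_∩ : H_*(P : Γ; A) → H^{n-*}(Γ; A)`. For `k ≤ n` this says that `c` is represented by the slant
product of an invariant `(n-k)`-cycle; an inhomogeneous cochain corresponds to the values of the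
homogeneous one at `[1, g₁, g₁g₂, …]`. For `k > n` the homology group of degree `n - k` is zero, and
so is the image in degree `k`. -/
def IsProperLipschitz {Γ : Type} [Group Γ] (S : Set Γ) {A : Rep.{0} ℤ Γ} {k : ℕ}
    (c : groupCohomology A k) : Prop :=
  ∃ (n : ℕ) (P : SimplicialGComplex Γ) (α : Γ → C(P.Point, Euc n))
    (ω : CompactCohomology.cocycles (Euc n) n),
    P.IsParameterSpace ∧ IsProperLipschitzMap S (fun γ x => α γ x) ∧
    CompactCohomology.IsGenerator ω ∧
    ((n < k ∧ c = 0) ∨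
      ∃ (l : ℕ) (z : P.Simplex l → A) (f : groupCohomology.cocycles A k),
        k + l = n ∧ SimplicialGComplex.IsInvariant z ∧ SimplicialGComplex.IsCycle z ∧
        (∀ g : Fin k → Γ,
          groupCohomology.iCocycles A k f g = slant ω.1 α z (Fin.partialProd g)) ∧
        groupCohomology.π A k f = c)

/-! ### The Berstein–Schwarz class -/

section BersteinSchwarz

variable (Γ : Type) [Group Γ]

/-- The augmentation `ε : ℤΓ → ℤ`, with `ε(g) = 1` for every `g ∈ Γ`. -/
def augmentation : Rep.leftRegular ℤ Γ ⟶ Rep.trivial ℤ Γ ℤ :=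
  Rep.leftRegularHom (Rep.trivial ℤ Γ ℤ) (1 : ℤ)

/-- The kernel of the augmentation. -/
def augmentationKer : Submodule ℤ (Rep.leftRegular ℤ Γ) :=
  LinearMap.ker (augmentation Γ).hom.toLinearMap

lemma augmentationKer_le (g : Γ) :
    augmentationKer Γ ≤ (augmentationKer Γ).comap ((Rep.leftRegular ℤ Γ).ρ g) := by
  intro x hx
  have h := Rep.hom_comm_apply (augmentation Γ) g x
  have hx' : (augmentation Γ).hom x = 0 := hx
  change (augmentation Γ).hom ((Rep.leftRegular ℤ Γ).ρ g x) = 0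
  rw [h, hx']
  exact map_zero _

/-- The augmentation ideal `I(Γ)` as a `ℤΓ`-module. -/
def augmentationIdeal : Rep.{0} ℤ Γ :=
  (Rep.leftRegular ℤ Γ).subrepresentation (augmentationKer Γ) (augmentationKer_le Γ)

/-- The sequence `0 → I(Γ) → ℤΓ → ℤ → 0`. -/
def augmentationSequence : ShortComplex (Rep.{0} ℤ Γ) where
  X₁ := augmentationIdeal Γ
  X₂ := Rep.leftRegular ℤ Γ
  X₃ := Rep.trivial ℤ Γ ℤ
  f := Rep.subtype _ (augmentationKer Γ) (augmentationKer_le Γ)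
  g := augmentation Γ
  zero := by
    ext x
    exact x.2

lemma rep_exact {k G : Type} [CommRing k] [Group G] (X : ShortComplex (Rep.{0} k G))
    (h : ∀ x : X.X₂, X.g.hom x = 0 → ∃ y : X.X₁, X.f.hom y = x) : X.Exact := by
  rw [← ShortComplex.exact_map_iff_of_faithful X (forget₂ (Rep.{0} k G) (ModuleCat k)),
    ShortComplex.moduleCat_exact_iff]
  exact h

lemma augmentationSequence_shortExact : (augmentationSequence Γ).ShortExact where
  exact := by
    exact rep_exact _ fun x hx => ⟨⟨x, hx⟩, rfl⟩
  mono_f := (Rep.mono_iff_injective _).2 fun _ _ h => Subtype.ext h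
  epi_g := (Rep.epi_iff_surjective _).2 fun m =>
    ⟨MonoidAlgebra.single 1 m, by
      refine (Rep.leftRegularHom_hom_single (A := Rep.trivial ℤ Γ ℤ) 1 (1 : ℤ) m).trans ?_
      exact mul_one (M := ℤ) m⟩

/-- The class `1 ∈ H⁰(Γ; ℤ)`. -/
def oneClass : groupCohomology (Rep.trivial ℤ Γ ℤ) 0 :=
  (groupCohomology.H0Iso (Rep.trivial ℤ Γ ℤ)).inv ⟨(1 : ℤ), fun _ => rfl⟩

/-- The Berstein–Schwarz class `β_Γ = δ(1) ∈ H¹(Γ; I(Γ))`. -/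
def bersteinSchwarzClass : groupCohomology (augmentationIdeal Γ) 1 :=
  groupCohomology.δ (augmentationSequence_shortExact Γ) 0 1 rfl (oneClass Γ)

end BersteinSchwarz

end

/-! Let an invariant `ℤ`-valued `n`-cycle `z` represent `1`. Since `Γ` permutes the simplices
freely, `z` lifts to an invariant `ℤΓ`-valued chain `y` (`exists_lift`), usually no longer a cycle.
Put `b γ = ∑_σ ω(ᾱ|[γ] × σ) y_σ`. Invariance gives `b γ = γ b(1)`, and `ε(b(1)) = 1` because `y`
lifts `z`; hence `g ↦ g b(1) - b(1)` represents `β_Γ` (`bersteinSchwarzClass_eq`).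

As `ε(∂y) = ∂z = 0`, the boundary `∂y` is an invariant cycle with coefficients in `I(Γ)`. Moving `∂`
across the pairing (`pairing_boundary`) and using `δω = 0` on the prisms `[γ₀, γ₁] × σ`
(`prism_formula`, `crossValue_sub`), the slant product of `∂y` at `[γ₀, γ₁]` is `b γ₁ - b γ₀`. So
`α_∩[∂y] = β_Γ`, with the same `P`, `α`, `ω`. All sums are finite by `finite_crossValue_ne_zero`. If
`n = 0`, then `b` is constant and `β_Γ = 0`. -/

noncomputable section

open CompactCohomology SimplicialGComplex

/-! ### Naturality of the singular simplices cut out of `ᾱ` -/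

section Naturality

variable {Γ : Type*} [Group Γ] {P : SimplicialGComplex Γ} {n : ℕ}

lemma stdSimplex_sum_map_smul {a b : ℕ} {M : Type*} [AddCommGroup M] [Module ℝ M]
    (g : Fin (a + 1) → Fin (b + 1)) (t : stdSimplex ℝ (Fin (a + 1))) (u : Fin (b + 1) → M) :
    ∑ i, (stdSimplex.map g t) i • u i = ∑ j, t j • u (g j) := by
  classical
  simp only [stdSimplex.map_coe, FunOnFinite.linearMap_apply_apply, Finset.sum_smul]
  rw [← Finset.sum_fiberwise (s := Finset.univ) (g := g) (f := fun j => t j • u (g j))]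
  refine Finset.sum_congr rfl fun i _ => Finset.sum_congr rfl fun j hj => ?_
  rw [(Finset.mem_filter.1 hj).2]

lemma toPoint_map {l m : ℕ} (σ : P.Simplex l) (τ : P.Simplex m) (g : Fin (m + 1) → Fin (l + 1))
    (h : ∀ j, τ.1 j = σ.1 (g j)) (t : stdSimplex ℝ (Fin (m + 1))) :
    σ.toPoint (stdSimplex.map g t) = τ.toPoint t := by
  classical
  refine Subtype.ext (funext fun v => ?_)
  have := stdSimplex_sum_map_smul g t fun i => if σ.1 i = v then (1 : ℝ) else 0
  simp only [smul_eq_mul, mul_ite, mul_one, mul_zero, ← h] at this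
  exact this

lemma smulPoint_toPoint {l : ℕ} (g : Γ) (σ : P.Simplex l) (t : stdSimplex ℝ (Fin (l + 1))) :
    P.smulPoint g (σ.toPoint t) = (σ.translate g).toPoint t := by
  classical
  refine Subtype.ext (funext fun v => ?_)
  change (∑ i, if σ.1 i = g⁻¹ • v then t i else 0) = ∑ i, if g • σ.1 i = v then t i else 0
  simp only [eq_inv_smul_iff]

lemma barExt_map (α : Γ → C(P.Point, Euc n)) {k m : ℕ} (γ : Fin (k + 1) → Γ)
    (e : Fin (m + 1) → Fin (k + 1)) (t : stdSimplex ℝ (Fin (m + 1))) (x : P.Point) :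
    barExt α γ (stdSimplex.map e t, x) = barExt α (fun j => γ (e j)) (t, x) :=
  stdSimplex_sum_map_smul e t fun i => α (γ i) x

/-- The singular simplex of `ℝⁿ` which `ᾱ` and a sequence of grid vertices define. -/
def gridMap (α : Γ → C(P.Point, Euc n)) {k l : ℕ} (N : ℕ) (γ : Fin (k + 1) → Γ)
    (σ : P.Simplex l) (f : Fin (N + 1) → Fin (k + 1) × Fin (l + 1)) :
    C(stdSimplex ℝ (Fin (N + 1)), Euc n) :=
  (barExt α γ).comp (((ContinuousMap.id _).prodMap σ.toPoint).comp (gridSimplex N k l f))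

lemma gridMap_apply (α : Γ → C(P.Point, Euc n)) {k l : ℕ} (N : ℕ) (γ : Fin (k + 1) → Γ)
    (σ : P.Simplex l) (f : Fin (N + 1) → Fin (k + 1) × Fin (l + 1))
    (t : stdSimplex ℝ (Fin (N + 1))) :
    gridMap α N γ σ f t = barExt α γ
      (stdSimplex.map (fun j => (f j).1) t, σ.toPoint (stdSimplex.map (fun j => (f j).2) t)) :=
  rfl

lemma gridMap_comp_faceMap (α : Γ → C(P.Point, Euc n)) {k l : ℕ} (N : ℕ) (γ : Fin (k + 1) → Γ)
    (σ : P.Simplex l) (f : Fin (N + 2) → Fin (k + 1) × Fin (l + 1)) (i : Fin (N + 2)) :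
    (gridMap α (N + 1) γ σ f).comp (faceMap i) = gridMap α N γ σ fun j => f (i.succAbove j) := by
  ext1 t
  change gridMap α (N + 1) γ σ f (stdSimplex.map i.succAbove t) = _
  rw [gridMap_apply, gridMap_apply, stdSimplex.map_comp_apply, stdSimplex.map_comp_apply]
  rfl

/-- Expresses faces of `σ` and endpoints of `[γ₀, γ₁]` through the grid of a single fixed prism,
where the prism formula applies. -/
lemma gridMap_map (α : Γ → C(P.Point, Euc n)) {k l k' l' : ℕ} (N : ℕ) (γ : Fin (k + 1) → Γ)
    (σ : P.Simplex l) (τ : P.Simplex l') (e : Fin (k' + 1) → Fin (k + 1))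
    (g : Fin (l' + 1) → Fin (l + 1)) (h : ∀ j, τ.1 j = σ.1 (g j))
    (f : Fin (N + 1) → Fin (k' + 1) × Fin (l' + 1)) :
    gridMap α N (fun j => γ (e j)) τ f = gridMap α N γ σ fun j => (e (f j).1, g (f j).2) := by
  ext1 t
  rw [gridMap_apply, gridMap_apply, ← toPoint_map σ τ g h, ← barExt_map,
    stdSimplex.map_comp_apply, stdSimplex.map_comp_apply]
  rfl

lemma gridMap_translate {S : Set Γ} {α : Γ → C(P.Point, Euc n)}
    (hα : IsProperLipschitzMap S (fun γ x => α γ x)) {k l : ℕ} (N : ℕ) (g : Γ)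
    (γ : Fin (k + 1) → Γ) (σ : P.Simplex l) (f : Fin (N + 1) → Fin (k + 1) × Fin (l + 1)) :
    gridMap α N (fun j => g * γ j) (σ.translate g) f = gridMap α N γ σ f := by
  ext1 t
  rw [gridMap_apply, gridMap_apply, ← smulPoint_toPoint]
  set u := stdSimplex.map (fun j => (f j).1) t
  set x := σ.toPoint (stdSimplex.map (fun j => (f j).2) t)
  change ∑ i, u i • α (g * γ i) (P.smulPoint g x) = ∑ i, u i • α (γ i) x
  exact Finset.sum_congr rfl fun i _ => congrArg _ (hα.invariant g (γ i) x)

lemma crossValue_translate {S : Set Γ} {α : Γ → C(P.Point, Euc n)}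
    (hα : IsProperLipschitzMap S (fun γ x => α γ x)) (ω : Cochain (Euc n) n) {k l : ℕ} (g : Γ)
    (γ : Fin (k + 1) → Γ) (σ : P.Simplex l) :
    crossValue ω α (fun j => g * γ j) (σ.translate g) = crossValue ω α γ σ := by
  refine Finset.sum_congr rfl fun f _ => ?_
  have := gridMap_translate hα n g γ σ f
  unfold gridMap at this
  rw [this]

end Naturality

/-! ### Finiteness of the slant sums -/

section Finiteness

variable {Γ : Type*} [Group Γ] {P : SimplicialGComplex Γ} {n : ℕ}

lemma toPoint_pos_mem {l : ℕ} (σ : P.Simplex l) (t : stdSimplex ℝ (Fin (l + 1))) (v : P.V)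
    (hv : 0 < (σ.toPoint t).1 v) : ∃ i, σ.1 i = v := by
  classical
  by_contra! h
  have h0 : (∑ i, if σ.1 i = v then t i else 0) = 0 :=
    Finset.sum_eq_zero fun i _ => if_neg (h i)
  exact hv.ne' h0

lemma exists_pos (x : P.Point) : ∃ v, 0 < x.1 v := by
  obtain ⟨h0, s, -, -, h1⟩ := x.2
  by_contra! h
  have : ∑ v ∈ s, x.1 v ≤ 0 := Finset.sum_nonpos fun v _ => h v
  linarith

lemma finite_simplices_containing (hP : P.IsParameterSpace) (l : ℕ) (v : P.V) :
    {σ : P.Simplex l | ∃ i, σ.1 i = v}.Finite := by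
  refine Set.Finite.of_finite_image (f := fun σ : P.Simplex l => σ.1) ?_
    Subtype.val_injective.injOn
  refine ((hP.locallyFinite v).biUnion fun s _ =>
    Set.Finite.pi' (fun _ : Fin (l + 1) => s.finite_toSet)).subset ?_
  rintro _ ⟨σ, ⟨i, rfl⟩, rfl⟩
  obtain ⟨s, hs, h⟩ := σ.2
  exact Set.mem_biUnion (x := s) ⟨hs, h i⟩ h

/-- The open stars `{x | 0 < x v}` cover `|P|`, so finitely many cover `C`, and each vertex lies on
finitely many ordered simplices. -/
lemma finite_simplices_meeting (hP : P.IsParameterSpace) (l : ℕ) {C : Set P.Point}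
    (hC : IsCompact C) : {σ : P.Simplex l | ∃ t, σ.toPoint t ∈ C}.Finite := by
  obtain ⟨T, hT⟩ := hC.elim_finite_subcover (fun v : P.V => {x : P.Point | 0 < x.1 v})
    (fun v => isOpen_lt continuous_const ((continuous_apply v).comp continuous_subtype_val))
    (fun x _ => Set.mem_iUnion.2 (exists_pos x))
  refine (T.finite_toSet.biUnion fun v _ => finite_simplices_containing hP l v).subset ?_
  rintro σ ⟨t, ht⟩
  obtain ⟨v, hv, hx⟩ := Set.mem_iUnion₂.1 (hT ht)
  exact Set.mem_biUnion hv (toPoint_pos_mem σ t v hx)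

/-- Balls are convex, and the Lipschitz condition puts every `α (γ i) x` in one ball about `α (γ 0)
x`. The radius does not depend on `x`. -/
lemma dist_barExt_le {S : Set Γ} {α : Γ → C(P.Point, Euc n)}
    (hα : IsProperLipschitzMap S (fun γ x => α γ x)) {k : ℕ} (γ : Fin (k + 1) → Γ)
    (t : stdSimplex ℝ (Fin (k + 1))) (x : P.Point) :
    dist (α (γ 0) x) (barExt α γ (t, x)) ≤ ∑ i, (wordDist S (γ i) (γ 0) : ℝ) := by
  set R : ℝ := ∑ i, (wordDist S (γ i) (γ 0) : ℝ)
  have h : barExt α γ (t, x) ∈ Metric.closedBall (α (γ 0) x) R := by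
    refine (convex_closedBall _ _).sum_mem (fun i _ => t.2.1 i) t.2.2 fun i _ => ?_
    rw [Metric.mem_closedBall]
    exact (hα.lipschitz x _ _).trans (Finset.single_le_sum
      (f := fun i => (wordDist S (γ i) (γ 0) : ℝ)) (fun _ _ => by positivity) (Finset.mem_univ i))
  rwa [Metric.mem_closedBall, dist_comm] at h

/-- A simplex that contributes has a point which `α (γ 0)` sends into a closed thickening of the
support of `ω`; by properness such points form a compact set. -/
lemma finite_crossValue_ne_zero {S : Set Γ} {α : Γ → C(P.Point, Euc n)}
    (hP : P.IsParameterSpace) (hα : IsProperLipschitzMap S (fun γ x => α γ x))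
    {ω : Cochain (Euc n) n} (hω : ω ∈ compactCochains (Euc n) n) {k : ℕ} (l : ℕ)
    (γ : Fin (k + 1) → Γ) : {σ : P.Simplex l | crossValue ω α γ σ ≠ 0}.Finite := by
  classical
  obtain ⟨K, hK, hω⟩ := hω
  have hC := (hα.proper (γ 0)).isCompact_preimage
    (hK.cthickening (r := ∑ i, (wordDist S (γ i) (γ 0) : ℝ)))
  refine (finite_simplices_meeting hP l hC).subset fun σ hσ => ?_
  obtain ⟨f, -, hf⟩ := Finset.exists_ne_zero_of_sum_ne_zero hσ
  rw [ite_ne_right_iff] at hf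
  have hf' := mt (hω _) (right_ne_zero_of_mul hf.2)
  obtain ⟨_, ⟨t, rfl⟩, ht⟩ := Set.not_disjoint_iff.1 hf'
  refine ⟨stdSimplex.map (fun j => (f j).2) t, ?_⟩
  exact Metric.mem_cthickening_of_dist_le _ _ _ _ ht (dist_barExt_le hα γ _ _)

end Finiteness

/-! ### Combinatorics of the prism `Δ¹ × Δᴺ` -/

section Prism

/-- The `j`-th maximal lattice path of the grid of the prism `Δ¹ × Δᴺ`. -/
def prismPath (N : ℕ) (j : Fin (N + 1)) (r : Fin (N + 2)) : Fin (1 + 1) × Fin (N + 1) :=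
  (if r ≤ j.castSucc then 0 else 1, j.predAbove r)

lemma prismPath_eq (N : ℕ) (j : Fin (N + 1)) (r : Fin (N + 2)) :
    ((prismPath N j r).1 : ℕ) = (if (r : ℕ) ≤ j then 0 else 1) ∧
      ((prismPath N j r).2 : ℕ) = if (r : ℕ) ≤ j then (r : ℕ) else r - 1 := by
  refine ⟨?_, ?_⟩
  · simp only [prismPath, Fin.le_def, Fin.val_castSucc]
    split_ifs <;> rfl
  · simp only [prismPath, Fin.predAbove, Fin.lt_def, Fin.val_castSucc]
    split_ifs <;> (simp; try omega)

lemma prismPath_strictMono (N : ℕ) (j : Fin (N + 1)) : StrictMono (prismPath N j) := by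
  intro r s hrs
  obtain ⟨h1, h2⟩ := prismPath_eq N j r
  obtain ⟨h3, h4⟩ := prismPath_eq N j s
  rw [Prod.lt_iff, Fin.lt_def, Fin.lt_def, Fin.le_def, Fin.le_def, h1, h2, h3, h4]
  rw [Fin.lt_def] at hrs
  split_ifs <;> omega

lemma prismPath_injective (N : ℕ) : Function.Injective (prismPath N) := by
  have key : ∀ i j : Fin (N + 1), i < j → prismPath N i ≠ prismPath N j := by
    intro i j hij h
    have h1 := (prismPath_eq N i j.castSucc).1
    have h2 := (prismPath_eq N j j.castSucc).1
    rw [Fin.lt_def] at hij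
    rw [h, h2] at h1
    simp only [Fin.val_castSucc, le_refl, if_true] at h1
    split_ifs at h1
    omega
  intro i j h
  rcases lt_trichotomy i j with hij | hij | hij
  · exact (key i j hij h).elim
  · exact hij
  · exact (key j i hij h.symm).elim

/-- The sum of the coordinates is a strictly increasing self-map of `Fin (N + 2)`, hence the
identity. -/
lemma strictMono_grid_height {N : ℕ} {f : Fin (N + 2) → Fin (1 + 1) × Fin (N + 1)}
    (hf : StrictMono f) (r : Fin (N + 2)) : ((f r).1 : ℕ) + (f r).2 = r := by
  have hlt (r : Fin (N + 2)) : ((f r).1 : ℕ) + (f r).2 < N + 2 := by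
    have := (f r).1.2
    have := (f r).2.2
    omega
  have hmono : StrictMono fun r => (⟨((f r).1 : ℕ) + (f r).2, hlt r⟩ : Fin (N + 2)) := by
    intro r s hrs
    have := hf hrs
    rw [Prod.lt_iff, Fin.lt_def, Fin.lt_def, Fin.le_def, Fin.le_def] at this
    rw [Fin.lt_def]
    dsimp only
    omega
  exact congrArg Fin.val (congrFun (Subsingleton.elim
    (hmono.orderIsoOfSurjective _ (Finite.surjective_of_injective hmono.injective))
    (OrderIso.refl _) |> congrArg DFunLike.coe) r)

lemma strictMono_grid_iff {N : ℕ} (f : Fin (N + 2) → Fin (1 + 1) × Fin (N + 1)) :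
    StrictMono f ↔ ∃ j, prismPath N j = f := by
  refine ⟨fun hf => ?_, ?_⟩
  swap
  · rintro ⟨j, rfl⟩
    exact prismPath_strictMono N j
  have hh := strictMono_grid_height hf
  have hne : ((Finset.univ.filter fun r => (f r).1 = 0)).Nonempty := by
    refine ⟨0, ?_⟩
    have := hh 0
    simp only [Finset.mem_filter, Finset.mem_univ, true_and, Fin.ext_iff, Fin.val_zero] at this ⊢
    omega
  -- The path leaves the bottom of the prism right after its last vertex `c` there, which determines
  -- it.
  obtain ⟨c, hc, hmax⟩ := (Finset.univ.filter fun r => (f r).1 = 0).exists_maximal hne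
  simp only [Finset.mem_filter, Finset.mem_univ, true_and] at hc hmax
  have hc2 := hh c
  have hcN := (f c).2.2
  simp only [hc, Fin.val_zero, zero_add] at hc2
  refine ⟨⟨c, by omega⟩, funext fun r => ?_⟩
  obtain ⟨h1, h2⟩ := prismPath_eq N ⟨c, by omega⟩ r
  have hr := hh r
  have hr1 := (f r).1.2
  have hfst : ((f r).1 : ℕ) = if (r : ℕ) ≤ c then 0 else 1 := by
    split_ifs with h
    · have := (Prod.le_def.1 (hf.monotone (Fin.le_def.2 h))).1
      rw [hc, Fin.le_def] at this
      simpa using this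
    · by_contra h'
      exact h (Fin.le_def.1 (hmax (Fin.ext (by simp; omega)) (Fin.le_def.2 (by omega))))
  refine Prod.ext (Fin.ext (h1.trans hfst.symm)) (Fin.ext (h2.trans ?_))
  dsimp only
  split_ifs at hfst ⊢ <;> omega

/-- Only the step from `(0, j)` to `(1, j)` changes the first coordinate, and it contributes `j`. -/
lemma gridSign_prismPath (N : ℕ) (j : Fin (N + 1)) :
    gridSign (N + 1) 1 N (prismPath N j) = (-1) ^ (j : ℕ) := by
  unfold gridSign
  congr 1
  rw [Finset.sum_eq_single j]
  · obtain ⟨h1, h2⟩ := prismPath_eq N j j.succ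
    obtain ⟨h3, h4⟩ := prismPath_eq N j j.castSucc
    rw [h1, h3, h4]
    simp
  · intro t _ ht
    obtain ⟨h1, h2⟩ := prismPath_eq N j t.succ
    obtain ⟨h3, h4⟩ := prismPath_eq N j t.castSucc
    rw [h1, h3]
    have : (t : ℕ) ≠ j := fun h => ht (Fin.ext h)
    simp only [Fin.val_succ, Fin.val_castSucc]
    split_ifs <;> omega
  · simp

/-- The sections of the prism which are the common faces of consecutive maximal simplices. -/
def prismSection (N c : ℕ) (r : Fin (N + 1)) : Fin (1 + 1) × Fin (N + 1) :=
  (if (r : ℕ) < c then 0 else 1, r)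

/-- Dropping `(0, j)` leaves the section with cut `j`; dropping `(1, j)`, in the next lemma, leaves
cut `j + 1`. So consecutive paths share a face. -/
lemma prismPath_succAbove_castSucc (N : ℕ) (j r : Fin (N + 1)) :
    prismPath N j (j.castSucc.succAbove r) = prismSection N j r := by
  obtain ⟨h1, h2⟩ := prismPath_eq N j (j.castSucc.succAbove r)
  refine Prod.ext (Fin.ext (h1.trans ?_)) (Fin.ext (h2.trans ?_)) <;>
  · simp only [prismSection, Fin.succAbove, Fin.lt_def, Fin.val_castSucc]
    split_ifs <;> (simp_all; try omega)

lemma prismPath_succAbove_succ (N : ℕ) (j r : Fin (N + 1)) :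
    prismPath N j ((j.castSucc.succAbove j).succAbove r) = prismSection N (j + 1) r := by
  obtain ⟨h1, h2⟩ := prismPath_eq N j ((j.castSucc.succAbove j).succAbove r)
  refine Prod.ext (Fin.ext (h1.trans ?_)) (Fin.ext (h2.trans ?_)) <;>
  · simp only [prismSection, Fin.succAbove, Fin.lt_def, Fin.val_castSucc, lt_irrefl, if_false,
      Fin.val_succ]
    split_ifs <;> (simp_all; try omega)

/-- For `q ≠ j` the `j`-th path has just one vertex over `q`, at position `j.castSucc.succAbove q`.
Dropping it leaves a maximal path of the prism over the `q`-th face. -/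
lemma prismPath_succAbove_of_ne (N : ℕ) (q : Fin (N + 2)) (p : Fin (N + 1)) (r : Fin (N + 2)) :
    prismPath (N + 1) (q.succAbove p) (((q.succAbove p).castSucc.succAbove q).succAbove r) =
      ((prismPath N p r).1, q.succAbove (prismPath N p r).2) := by
  obtain ⟨h1, h2⟩ := prismPath_eq (N + 1) (q.succAbove p)
    (((q.succAbove p).castSucc.succAbove q).succAbove r)
  obtain ⟨h3, h4⟩ := prismPath_eq N p r
  refine Prod.ext (Fin.ext (h1.trans ?_)) (Fin.ext (h2.trans ?_))
  · rw [h3]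
    simp only [Fin.succAbove, Fin.lt_def, Fin.val_castSucc, apply_ite Fin.val, Fin.val_succ]
    split_ifs <;> omega
  · simp only [Fin.succAbove, Fin.lt_def, Fin.val_castSucc, apply_ite Fin.val, Fin.val_succ, h4]
    split_ifs <;> omega

lemma sum_eq_diag_add_sum_succAbove {M : Type*} [AddCommMonoid M] {N : ℕ}
    (a : Fin (N + 1) → Fin (N + 1) → M) :
    ∑ j, ∑ q, a j q = ∑ j, a j j + ∑ q, ∑ p : Fin N, a (q.succAbove p) q := by
  rw [Finset.sum_comm, ← Finset.sum_add_distrib]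
  exact Finset.sum_congr rfl fun q _ => Fin.sum_univ_succAbove (fun j => a j q) q

lemma neg_one_pow_succAbove {N : ℕ} (q : Fin (N + 2)) (p : Fin (N + 1)) :
    (-1 : ℤ) ^ ((q.succAbove p : Fin (N + 2)) : ℕ) *
      (-1) ^ (((q.succAbove p).castSucc.succAbove q : Fin (N + 3)) : ℕ) =
      -((-1) ^ (q : ℕ) * (-1) ^ (p : ℕ)) := by
  rcases lt_or_ge p.castSucc q with h | h
  · rw [Fin.succAbove_of_castSucc_lt _ _ h, Fin.succAbove_of_le_castSucc, Fin.val_succ,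
      Fin.val_castSucc, pow_succ]
    · ring
    · exact Fin.le_def.2 (Fin.lt_def.1 h).le
  · rw [Fin.succAbove_of_le_castSucc _ _ h, Fin.succAbove_of_castSucc_lt, Fin.val_succ,
      Fin.val_castSucc, pow_succ]
    · ring
    · rw [Fin.lt_def]
      rw [Fin.le_def] at h
      simp at h ⊢
      omega

/-- Sum the cocycle relation over the maximal paths with their signs. Interior sections cancel in
pairs, leaving top minus bottom; the other faces make up the prisms over the faces of the base. -/
lemma prism_formula {N : ℕ} (w : (Fin (N + 2) → Fin (1 + 1) × Fin (N + 2)) → ℤ)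
    (hw : ∀ F : Fin (N + 3) → Fin (1 + 1) × Fin (N + 2),
      ∑ i : Fin (N + 3), (-1 : ℤ) ^ (i : ℕ) * w (fun r => F (i.succAbove r)) = 0) :
    w (fun r => (1, r)) - w (fun r => (0, r)) =
      ∑ q : Fin (N + 2), (-1 : ℤ) ^ (q : ℕ) * ∑ p : Fin (N + 1), (-1 : ℤ) ^ (p : ℕ) *
        w (fun r => ((prismPath N p r).1, q.succAbove (prismPath N p r).2)) := by
  have h : ∑ j : Fin (N + 2), (-1 : ℤ) ^ (j : ℕ) * ∑ i : Fin (N + 3), (-1 : ℤ) ^ (i : ℕ) *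
      w (fun r => prismPath (N + 1) j (i.succAbove r)) = 0 :=
    Finset.sum_eq_zero fun j _ => by rw [hw, mul_zero]
  -- Face `j` is split off; the remaining faces are indexed by `q`, and `q = j` then gives the
  -- second section of the path.
  simp only [fun j : Fin (N + 2) => Fin.sum_univ_succAbove (fun i : Fin (N + 3) =>
    (-1 : ℤ) ^ (i : ℕ) * w (fun r => prismPath (N + 1) j (i.succAbove r))) j.castSucc,
    mul_add, Finset.sum_add_distrib, Finset.mul_sum, prismPath_succAbove_castSucc] at h
  rw [sum_eq_diag_add_sum_succAbove] at h
  simp only [prismPath_succAbove_succ, prismPath_succAbove_of_ne, ← mul_assoc,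
    neg_one_pow_succAbove] at h
  have hdiag (j : Fin (N + 2)) : (-1 : ℤ) ^ (j : ℕ) *
      (-1) ^ ((j.castSucc.succAbove j : Fin (N + 3)) : ℕ) = -1 := by
    rw [Fin.succAbove_castSucc_self, Fin.val_succ, ← pow_add]
    exact Odd.neg_one_pow ⟨j, by ring⟩
  have hdiag' (j : Fin (N + 2)) :
      (-1 : ℤ) ^ (j : ℕ) * (-1) ^ ((j.castSucc : Fin (N + 3)) : ℕ) = 1 := by
    rw [Fin.val_castSucc, ← pow_add]
    exact Even.neg_one_pow ⟨j, rfl⟩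
  simp only [hdiag, hdiag', one_mul, neg_mul, Finset.sum_neg_distrib] at h
  have htel : ∑ j : Fin (N + 2), w (prismSection (N + 1) j) -
      ∑ j : Fin (N + 2), w (prismSection (N + 1) (j + 1)) =
      w (fun r => (1, r)) - w (fun r => (0, r)) := by
    rw [← Finset.sum_sub_distrib, Fin.sum_univ_eq_sum_range (fun j =>
      w (prismSection (N + 1) j) - w (prismSection (N + 1) (j + 1))), Finset.sum_range_sub']
    congr 2
    funext r
    exact Prod.ext (if_pos r.2) rfl
  simp only [Finset.mul_sum, ← mul_assoc]
  change ∑ j : Fin (N + 2), w (prismSection (N + 1) j) +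
    (-∑ j : Fin (N + 2), w (prismSection (N + 1) (j + 1)) + _) = 0 at h
  linarith

end Prism

/-! ### Cross values in degrees zero and one -/

section CrossValue

variable {Γ : Type*} [Group Γ] {P : SimplicialGComplex Γ}

lemma strictMono_fin_one_prod_iff {n : ℕ} (f : Fin (n + 1) → Fin (0 + 1) × Fin (n + 1)) :
    StrictMono f ↔ (fun r => (0, r)) = f := by
  constructor
  · intro hf
    have hmono : StrictMono fun r => (f r).2 := fun r s hrs => by
      have := hf hrs
      rw [Prod.lt_iff] at this
      rcases this with ⟨h, -⟩ | ⟨-, h⟩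
      · exact (h.ne (Fin.ext (by omega))).elim
      · exact h
    have h := congrArg DFunLike.coe (Subsingleton.elim
      (hmono.orderIsoOfSurjective _ (Finite.surjective_of_injective hmono.injective))
      (OrderIso.refl _))
    exact funext fun r => Prod.ext (Fin.ext (by omega)) (congrFun h r).symm
  · rintro rfl r s hrs
    exact Prod.lt_iff.2 (Or.inr ⟨le_rfl, hrs⟩)

lemma crossValue_zero {n : ℕ} (ω : Cochain (Euc n) n) (α : Γ → C(P.Point, Euc n))
    (γ : Fin (0 + 1) → Γ) (σ : P.Simplex n) :
    crossValue ω α γ σ = ω (gridMap α n γ σ fun r => (0, r)) := by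
  classical
  unfold crossValue
  simp only [strictMono_fin_one_prod_iff]
  rw [Finset.sum_ite_eq, if_pos (Finset.mem_univ _)]
  refine (congrArg (· * _) ?_).trans (one_mul _)
  simp [gridSign]

lemma crossValue_one {N : ℕ} (ω : Cochain (Euc (N + 1)) (N + 1))
    (α : Γ → C(P.Point, Euc (N + 1))) (γ : Fin (1 + 1) → Γ) (σ : P.Simplex N) :
    crossValue ω α γ σ =
      ∑ p : Fin (N + 1), (-1) ^ (p : ℕ) * ω (gridMap α (N + 1) γ σ (prismPath N p)) := by
  classical
  unfold crossValue
  rw [← Finset.sum_filter]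
  have : (Finset.univ.filter fun f : Fin (N + 2) → Fin (1 + 1) × Fin (N + 1) => StrictMono f) =
      Finset.univ.image (prismPath N) := by
    ext f
    simp [strictMono_grid_iff]
  refine (Finset.sum_congr this fun _ _ => rfl).trans ?_
  rw [Finset.sum_image (prismPath_injective N).injOn]
  exact Finset.sum_congr rfl fun p _ => congrArg (· * _) (gridSign_prismPath N p)

/-- The simplicial coboundary of integral ordered cochains. -/
def simplicialCoboundary {l : ℕ} (c : P.Simplex l → ℤ) (σ : P.Simplex (l + 1)) : ℤ :=
  ∑ i : Fin (l + 2), (-1 : ℤ) ^ (i : ℕ) * c (σ.face i)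

lemma crossValue_sub {N : ℕ} {ω : Cochain (Euc (N + 1)) (N + 1)}
    (hω : ω ∈ (coboundary (Euc (N + 1)) (N + 1)).ker)
    (α : Γ → C(P.Point, Euc (N + 1))) (γ : Fin (1 + 1) → Γ) (σ : P.Simplex (N + 1)) :
    crossValue ω α (fun _ : Fin (0 + 1) => γ 1) σ - crossValue ω α (fun _ : Fin (0 + 1) => γ 0) σ =
      simplicialCoboundary (crossValue ω α γ) σ := by
  have h := prism_formula (fun f => ω (gridMap α (N + 1) γ σ f)) fun F => by
    simpa only [coboundary, AddMonoidHom.coe_mk, ZeroHom.coe_mk, gridMap_comp_faceMap,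
      Pi.zero_apply] using congrFun hω (gridMap α (N + 2) γ σ F)
  have hface (q : Fin (N + 2)) (f) : gridMap α (N + 1) γ (σ.face q) f =
      gridMap α (N + 1) γ σ fun r => ((f r).1, q.succAbove (f r).2) :=
    gridMap_map α (N + 1) γ σ (σ.face q) id q.succAbove (fun _ => rfl) f
  have hend (e : Fin (1 + 1)) : gridMap α (N + 1) (fun _ : Fin (0 + 1) => γ e) σ
      (fun r => (0, r)) = gridMap α (N + 1) γ σ fun r => (e, r) :=
    gridMap_map α (N + 1) γ σ σ (fun _ => e) id (fun _ => rfl) _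
  simp only [simplicialCoboundary, crossValue_zero, crossValue_one, hface, hend]
  exact h

end CrossValue

/-! ### Infinite chains, their boundary and equivariant lifting -/

section Chains

variable {Γ : Type*} [Group Γ] {P : SimplicialGComplex Γ}

lemma finite_face_preimage (hP : P.IsParameterSpace) {l : ℕ} (i : Fin (l + 2)) (τ : P.Simplex l) :
    {σ : P.Simplex (l + 1) | σ.face i = τ}.Finite := by
  refine (finite_simplices_containing hP (l + 1) (τ.1 0)).subset ?_
  rintro σ rfl
  exact ⟨i.succAbove 0, rfl⟩

lemma finite_support_simplicialCoboundary (hP : P.IsParameterSpace) {l : ℕ}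
    {c : P.Simplex l → ℤ} (hc : c.support.Finite) : (simplicialCoboundary c).support.Finite := by
  refine (Set.finite_iUnion fun i => hc.biUnion fun τ _ => finite_face_preimage hP i τ).subset ?_
  intro σ hσ
  obtain ⟨i, -, hi⟩ := Finset.exists_ne_zero_of_sum_ne_zero hσ
  exact Set.mem_iUnion.2 ⟨i, Set.mem_biUnion (right_ne_zero_of_mul hi) rfl⟩

lemma simplicialCoboundary_simplicialCoboundary {l : ℕ} (c : P.Simplex l → ℤ)
    (σ : P.Simplex (l + 2)) : simplicialCoboundary (simplicialCoboundary c) σ = 0 := by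
  simp only [simplicialCoboundary, Finset.mul_sum, ← mul_assoc, ← pow_add]
  rw [← Finset.sum_product']
  refine Finset.sum_involution (fun p _ => (p.1.succAbove p.2, p.2.predAbove p.1))
    ?_ (fun p _ _ h => Fin.succAbove_ne p.1 p.2 (congrArg Prod.fst h))
    (fun _ _ => Finset.mem_product.2 ⟨Finset.mem_univ _, Finset.mem_univ _⟩)
    (fun p _ => Prod.ext (Fin.succAbove_succAbove_predAbove _ _)
      (Fin.predAbove_predAbove_succAbove _ _))
  rintro ⟨i, j⟩ -
  have h : (σ.face (i.succAbove j)).face (j.predAbove i) = (σ.face i).face j :=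
    Subtype.ext (funext fun r => congrArg σ.1 (Fin.succAbove_succAbove_succAbove_predAbove i j r))
  rw [Fin.neg_one_pow_succAbove_add_predAbove, h, neg_mul, add_neg_cancel]

/-- The pairing `∑ c(σ) λ_σ` of an integral cochain with a possibly infinite chain. -/
def pairing {M : Type*} [AddCommGroup M] {l : ℕ} (c : P.Simplex l → ℤ)
    (z : P.Simplex l → M) : M :=
  ∑ᶠ σ, c σ • z σ

section Pairing

variable {M N : Type*} [AddCommGroup M] [AddCommGroup N] {l : ℕ}

lemma finite_support_smul {c : P.Simplex l → ℤ} (hc : c.support.Finite) (z : P.Simplex l → M) :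
    (Function.support fun σ => c σ • z σ).Finite :=
  hc.subset fun σ hσ h => hσ (by simp only [h, zero_smul])

lemma pairing_sub {c c' : P.Simplex l → ℤ} (hc : c.support.Finite) (hc' : c'.support.Finite)
    (z : P.Simplex l → M) : pairing (fun σ => c σ - c' σ) z = pairing c z - pairing c' z := by
  unfold pairing
  rw [← finsum_sub_distrib (finite_support_smul hc z) (finite_support_smul hc' z)]
  simp only [sub_smul]

lemma map_pairing {c : P.Simplex l → ℤ} (hc : c.support.Finite) (z : P.Simplex l → M)
    (f : M →+ N) : f (pairing c z) = pairing c fun σ => f (z σ) := by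
  unfold pairing
  rw [f.map_finsum (finite_support_smul hc z)]
  simp only [map_zsmul]

end Pairing

/-- A morphism of representations as a homomorphism of abelian groups. -/
def repHomAddMonoidHom {A B : Rep.{0} ℤ Γ} (f : A ⟶ B) : A →+ B :=
  AddMonoidHom.mk' (fun x => f.hom x) (map_add f.hom)

variable {A : Rep.{0} ℤ Γ} {l : ℕ}

open Classical in
-- Reduces statements about boundaries of infinite chains to finitely supported cochains: local
-- finiteness makes the coboundary of an indicator finitely supported.
lemma boundary_eq_pairing (hP : P.IsParameterSpace) (z : P.Simplex (l + 1) → A)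
    (τ : P.Simplex l) : boundary z τ = pairing (simplicialCoboundary (Pi.single τ 1)) z := by
  unfold boundary pairing simplicialCoboundary
  simp only [Finset.sum_smul]
  rw [finsum_sum_comm]
  · refine Finset.sum_congr rfl fun i _ => ?_
    rw [smul_finsum']
    · refine finsum_congr fun σ => ?_
      by_cases h : σ.face i = τ
      · simp [h]
      · simp [h]
    · refine (finite_face_preimage hP i τ).subset fun σ hσ => ?_
      by_contra h
      have : IsEmpty (σ.face i = τ) := ⟨h⟩
      exact hσ (finsum_of_isEmpty _)
  · intro i _
    refine (finite_face_preimage hP i τ).subset fun σ hσ => ?_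
    by_contra h
    refine hσ ?_
    simp [Pi.single_eq_of_ne h]

/-- Adjointness of `∂` and `δ`; the finite support of `c` and local finiteness permit the exchange
of sums. -/
lemma pairing_boundary (hP : P.IsParameterSpace) {c : P.Simplex l → ℤ} (hc : c.support.Finite)
    (z : P.Simplex (l + 1) → A) :
    pairing c (boundary z) = pairing (simplicialCoboundary c) z := by
  classical
  have h1 : pairing c (boundary z) = ∑ τ ∈ hc.toFinset, c τ • boundary z τ :=
    finsum_eq_sum_of_support_subset _ fun τ hτ => by
      rw [Set.Finite.coe_toFinset]
      intro h
      exact hτ (by simp only [h, zero_smul])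
  have hfin (τ : P.Simplex l) : (Function.support fun σ : P.Simplex (l + 1) =>
      simplicialCoboundary (Pi.single τ 1) σ • z σ).Finite :=
    finite_support_smul (finite_support_simplicialCoboundary hP
      ((Set.finite_singleton τ).subset Pi.support_single_subset)) z
  rw [h1]
  simp only [boundary_eq_pairing hP, pairing]
  simp only [fun τ => smul_finsum' (c τ) (hfin τ)]
  rw [← finsum_sum_comm]
  · refine finsum_congr fun σ => ?_
    simp only [smul_smul, ← Finset.sum_smul]
    congr 1
    simp only [simplicialCoboundary, Finset.mul_sum]
    rw [Finset.sum_comm]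
    refine Finset.sum_congr rfl fun i _ => ?_
    rw [Finset.sum_eq_single (σ.face i)]
    · simp [mul_comm]
    · intro τ _ hτ
      simp [Pi.single_eq_of_ne hτ.symm]
    · intro h
      simp at h
      simp [h]
  · intro τ _
    exact (hfin τ).subset fun σ hσ h => hσ (by simp only [h, smul_zero])

lemma boundary_boundary (hP : P.IsParameterSpace) (z : P.Simplex (l + 2) → A) (τ : P.Simplex l) :
    boundary (boundary z) τ = 0 := by
  classical
  rw [boundary_eq_pairing hP, pairing_boundary hP]
  · simp [pairing, simplicialCoboundary_simplicialCoboundary]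
  · exact finite_support_simplicialCoboundary hP
      ((Set.finite_singleton τ).subset Pi.support_single_subset)

lemma map_boundary (hP : P.IsParameterSpace) {B : Rep.{0} ℤ Γ} (z : P.Simplex (l + 1) → A)
    (f : A ⟶ B) (τ : P.Simplex l) :
    f.hom (boundary z τ) = boundary (fun σ => f.hom (z σ)) τ := by
  classical
  rw [boundary_eq_pairing hP, boundary_eq_pairing hP]
  exact map_pairing (finite_support_simplicialCoboundary hP
      ((Set.finite_singleton τ).subset Pi.support_single_subset)) z (repHomAddMonoidHom f)

variable (P) in
/-- Translation of simplices as a bijection. -/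
def translateEquiv (l : ℕ) (g : Γ) : P.Simplex l ≃ P.Simplex l where
  toFun := Simplex.translate g
  invFun := Simplex.translate g⁻¹
  left_inv σ := Subtype.ext (funext fun j => inv_smul_smul g (σ.1 j))
  right_inv σ := Subtype.ext (funext fun j => smul_inv_smul g (σ.1 j))

lemma pairing_translate {z : P.Simplex l → A} (hz : IsInvariant z) {c c' : P.Simplex l → ℤ}
    (hc : c.support.Finite) (g : Γ) (h : ∀ σ : P.Simplex l, c' (σ.translate g) = c σ) :
    pairing c' z = A.ρ g (pairing c z) := by
  refine Eq.trans ?_ (map_pairing hc z (A.ρ g).toAddMonoidHom).symm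
  unfold pairing
  rw [← finsum_comp_equiv (translateEquiv P l g)]
  refine finsum_congr fun σ => ?_
  change c' (σ.translate g) • z (σ.translate g) = _
  rw [h, hz]
  rfl

lemma isInvariant_boundary (hP : P.IsParameterSpace) {z : P.Simplex (l + 1) → A}
    (hz : IsInvariant z) : IsInvariant (boundary z) := by
  classical
  intro g τ
  rw [boundary_eq_pairing hP, boundary_eq_pairing hP]
  refine pairing_translate hz (finite_support_simplicialCoboundary hP
    ((Set.finite_singleton τ).subset Pi.support_single_subset)) g fun σ => ?_
  refine Finset.sum_congr rfl fun i _ => congrArg _ ?_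
  have : (σ.translate g).face i = τ.translate g ↔ σ.face i = τ :=
    (translateEquiv P l g).injective.eq_iff (a := σ.face i)
  simp only [Pi.single_apply, this]

lemma translate_eq_self (hP : P.IsParameterSpace) {g : Γ} {σ : P.Simplex l}
    (h : σ.translate g = σ) : g = 1 := by
  classical
  exact hP.free g (σ.toPoint (stdSimplex.vertex 0)) (by rw [smulPoint_toPoint, h])

/-- Choose a representative in each orbit; by freeness exactly one group element carries it to a
given simplex. -/
lemma exists_equivariant (hP : P.IsParameterSpace) (l : ℕ) :
    ∃ c : P.Simplex l → Γ, ∀ (g : Γ) (σ : P.Simplex l), c (σ.translate g) = g * c σ := by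
  have hmul (g h : Γ) (σ : P.Simplex l) : (σ.translate h).translate g = σ.translate (g * h) :=
    Subtype.ext (funext fun j => (mul_smul g h (σ.1 j)).symm)
  have hone (σ : P.Simplex l) : σ.translate (1 : Γ) = σ :=
    Subtype.ext (funext fun j => one_smul Γ (σ.1 j))
  let r : Setoid (P.Simplex l) :=
    { r := fun σ τ => ∃ g : Γ, σ.translate g = τ
      iseqv :=
        { refl := fun σ => ⟨1, hone σ⟩
          symm := by
            rintro σ _ ⟨g, rfl⟩
            exact ⟨g⁻¹, by rw [hmul, inv_mul_cancel, hone]⟩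
          trans := by
            rintro σ _ _ ⟨g, rfl⟩ ⟨h, rfl⟩
            exact ⟨h * g, (hmul h g σ).symm⟩ } }
  choose c hc using fun σ : P.Simplex l => Quotient.exact (s := r) (Quotient.out_eq ⟦σ⟧)
  refine ⟨c, fun g σ => ?_⟩
  have hq : (⟦σ.translate g⟧ : Quotient r) = ⟦σ⟧ := Quotient.sound (s := r) ⟨g⁻¹, by
    rw [hmul, inv_mul_cancel, hone]⟩
  have h1 := hc (σ.translate g)
  rw [hq] at h1
  have h2 : (Quotient.out (⟦σ⟧ : Quotient r)).translate (g * c σ) = σ.translate g := by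
    rw [← hmul, hc]
  have h3 : (Quotient.out (⟦σ⟧ : Quotient r)).translate ((g * c σ)⁻¹ * c (σ.translate g)) =
      Quotient.out (⟦σ⟧ : Quotient r) := by
    rw [← hmul, h1, ← h2, hmul, inv_mul_cancel, hone]
  exact (inv_mul_eq_one.1 (translate_eq_self hP h3)).symm

end Chains

/-! ### The classes `1` and `β_Γ` on cochains -/

section Cohomology

variable {Γ : Type} [Group Γ]

lemma iCocycles_of_π_eq_oneClass (f : groupCohomology.cocycles (Rep.trivial ℤ Γ ℤ) 0)
    (hf : groupCohomology.π _ 0 f = oneClass Γ) (g : Fin 0 → Γ) :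
    groupCohomology.iCocycles _ 0 f g = (1 : ℤ) := by
  have h1 := groupCohomology.cocyclesIso₀_hom_comp_f_apply (Rep.trivial ℤ Γ ℤ) f
  have h2 : (groupCohomology.H0Iso (Rep.trivial ℤ Γ ℤ)).hom (oneClass Γ) = 
      ⟨(1 : ℤ), fun _ => rfl⟩ :=
    Iso.inv_hom_id_apply (groupCohomology.H0Iso (Rep.trivial ℤ Γ ℤ)) _
  rw [← groupCohomology.π_comp_H0Iso_hom_apply, hf, h2] at h1
  rw [Subsingleton.elim g default]
  exact h1.symm

/-- This is the recipe for `δ`: lift `1` to any element of augmentation one and take its coboundary.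
-/
lemma bersteinSchwarzClass_eq (y : Rep.leftRegular ℤ Γ)
    (hy : (augmentation Γ).hom y = (1 : ℤ)) (x : Γ → augmentationIdeal Γ)
    (hx : ∀ g, (x g).1 = (Rep.leftRegular ℤ Γ).ρ g y - y) :
    ∃ f : groupCohomology.cocycles (augmentationIdeal Γ) 1,
      (∀ g : Fin 1 → Γ, groupCohomology.iCocycles (augmentationIdeal Γ) 1 f g = x (g 0)) ∧
      groupCohomology.π (augmentationIdeal Γ) 1 f = bersteinSchwarzClass Γ := by
  have hx' : (augmentationSequence Γ).f.hom ∘ x =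
      groupCohomology.d₀₁ (augmentationSequence Γ).X₂ y := funext hx
  have h := groupCohomology.δ₀_apply (augmentationSequence_shortExact Γ)
    ⟨(1 : ℤ), fun _ => rfl⟩ y hy x hx'
  refine ⟨_, fun g => ?_, h.symm⟩
  have h2 := groupCohomology.isoCocycles₁_inv_comp_iCocycles_apply (augmentationIdeal Γ)
    ⟨x, groupCohomology.mem_cocycles₁_of_comp_eq_d₀₁ (augmentationSequence_shortExact Γ) hx'⟩
  exact congrFun h2 g

lemma exists_lift {P : SimplicialGComplex Γ} (hP : P.IsParameterSpace) {l : ℕ}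
    {z : P.Simplex l → Rep.trivial ℤ Γ ℤ} (hz : IsInvariant z) :
    ∃ y : P.Simplex l → Rep.leftRegular ℤ Γ, IsInvariant y ∧
      ∀ σ, (augmentation Γ).hom (y σ) = z σ := by
  obtain ⟨c, hc⟩ := exists_equivariant hP l
  -- The coefficient of `σ` is placed at the group element `c σ`; since `Γ` acts trivially on `ℤ`,
  -- `z` is constant on orbits.
  refine ⟨fun σ => MonoidAlgebra.single (c σ) (z σ), fun g σ => ?_, fun σ => ?_⟩
  · have hz' : z (σ.translate g) = z σ := hz g σ
    dsimp only
    rw [hc, hz']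
    exact (Representation.ofMulAction_single g (c σ) (z σ)).symm
  · refine (Rep.leftRegularHom_hom_single (A := Rep.trivial ℤ Γ ℤ) (c σ) (1 : ℤ) (z σ)).trans ?_
    exact mul_one (M := ℤ) (z σ)

end Cohomology

/-! ### Transfer from `1` to `β_Γ` -/

theorem mainTheorem6 (Γ : Type) [Group Γ] (S : Finset Γ)
    (hS : Subgroup.closure (S : Set Γ) = ⊤)
    (h : IsProperLipschitz (S : Set Γ) (oneClass Γ)) :
    IsProperLipschitz (S : Set Γ) (bersteinSchwarzClass Γ) := by
  obtain ⟨n, P, α, ω, hP, hα, hω, ⟨hn, -⟩ | ⟨l, z, f, hl, hz, hcyc, hf, hπ⟩⟩ := h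
  · exact absurd hn (Nat.not_lt_zero n)
  obtain rfl : l = n := by omega
  obtain ⟨y, hy, hyz⟩ := exists_lift hP hz
  have hfin {k m : ℕ} (γ : Fin (k + 1) → Γ) :
      (Function.support fun σ : P.Simplex m => crossValue ω.1 α γ σ).Finite :=
    finite_crossValue_ne_zero hP hα ω.2.1 m γ
  let b (γ : Γ) : Rep.leftRegular ℤ Γ := pairing (crossValue ω.1 α fun _ : Fin (0 + 1) => γ) y
  have hb (g : Γ) : b g = (Rep.leftRegular ℤ Γ).ρ g (b 1) := by
    refine pairing_translate hy (hfin _) g fun σ => ?_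
    rw [← crossValue_translate hα ω.1 g _ σ, mul_one]
  have hb1 : (augmentation Γ).hom (b 1) = (1 : ℤ) := by
    refine (map_pairing (hfin _) y (repHomAddMonoidHom (augmentation Γ))).trans ?_
    have h1 := iCocycles_of_π_eq_oneClass f hπ Fin.elim0
    rw [hf] at h1
    refine Eq.trans ?_ h1
    have hpp : (fun _ : Fin (0 + 1) => (1 : Γ)) = Fin.partialProd Fin.elim0 := by
      funext i
      rw [Subsingleton.elim (α := Fin 1) i 0, Fin.partialProd_zero]
    rw [← hpp]
    exact congrArg (pairing _) (funext hyz)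
  refine ⟨l, P, α, ω, hP, hα, hω, ?_⟩
  obtain _ | m := l
  -- `ℝ⁰` is a point, so `b` is constant and `β_Γ` vanishes, as the alternative `n < k` demands.
  · have hconst (g : Γ) : (Rep.leftRegular ℤ Γ).ρ g (b 1) - b 1 = 0 := by
      rw [← hb, sub_eq_zero]
      refine congrArg (fun c => pairing c y) (funext fun σ => ?_)
      rw [crossValue_zero, crossValue_zero]
      refine congrArg ω.1 (ContinuousMap.ext fun t => ?_)
      ext i
      exact i.elim0
    obtain ⟨f', hf', hπ'⟩ := bersteinSchwarzClass_eq (b 1) hb1 0 fun g => (hconst g).symm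
    refine Or.inl ⟨Nat.zero_lt_one, ?_⟩
    have : f' = 0 := by
      refine (ModuleCat.mono_iff_injective (groupCohomology.iCocycles _ 1)).1 inferInstance ?_
      rw [map_zero]
      exact funext hf'
    rw [← hπ', this, map_zero]
  · have hker (τ : P.Simplex m) : boundary y τ ∈ augmentationKer Γ := by
      refine (map_boundary hP y (augmentation Γ) τ).trans ?_
      rw [show (fun σ => (augmentation Γ).hom (y σ)) = z from funext hyz]
      exact hcyc τ
    let w (τ : P.Simplex m) : augmentationIdeal Γ := ⟨boundary y τ, hker τ⟩
    let ι : augmentationIdeal Γ ⟶ Rep.leftRegular ℤ Γ := (augmentationSequence Γ).f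
    have hι : Function.Injective ι.hom := Subtype.val_injective
    have hslant (γ : Fin (1 + 1) → Γ) :
        (slant ω.1 α w γ).1 = b (γ 1) - b (γ 0) := by
      refine (map_pairing (hfin γ) w (repHomAddMonoidHom ι)).trans ?_
      refine (pairing_boundary hP (hfin γ) y).trans ?_
      rw [← pairing_sub (hfin _) (hfin _)]
      exact congrArg (fun c => pairing c y) (funext fun σ => (crossValue_sub ω.2.2 α γ σ).symm)
    obtain ⟨f', hf', hπ'⟩ := bersteinSchwarzClass_eq (b 1) hb1
      (fun g => slant ω.1 α w ![1, g]) fun g => by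
        rw [hslant, ← hb]
        rfl
    refine Or.inr ⟨m, w, f', by omega, fun g σ => ?_, ?_, fun g => ?_, hπ'⟩
    · exact Subtype.ext (isInvariant_boundary hP hy g σ)
    -- In degree zero every chain is a cycle; above that, `∂∂y = 0` is tested in `ℤΓ`.
    · obtain _ | m := m
      · trivial
      · intro τ
        refine hι ((map_boundary hP w ι τ).trans ?_)
        rw [map_zero]
        exact boundary_boundary hP y τ
    · rw [hf']
      congr 1
      funext i
      refine Fin.cases rfl (fun j => ?_) i
      rw [Subsingleton.elim (α := Fin 1) j 0]
      exact ((Fin.partialProd_succ g 0).trans (one_mul (g 0))).symm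

end
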